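/- Let $M$ be a smooth ($C^\infty$, Hausdorff, without boundary) manifold of dimension $n$, let $\mathbb K$ be $\mathbb R$ or $\mathbb C$, and let $\lambda,\mu\in\mathbb K$. For $\lambda\in\mathbb K$ let $\mathcal F_\lambda(M)$ be the space of smooth $\mathbb K$-valued tensor densities of degree $\lambda$ on $M$, i.e. of smooth sections of $|\Lambda^nT^*M|^{\otimes\lambda}$ (complexified if $\mathbb K=\mathbb C$), with the Lie derivative given in local coordinates by $L^\lambda_X\phi=X^i\partial_i\phi+\lambda\,(\partial_iX^i)\,\phi$ for a smooth (real) vector field $X\in\mathrm{Vect}(M)$. For an integer $k\ge 0$ let $\mathcal D^k_\lambda(M)$ be the space of linear differential operators $A:\mathcal F_\lambda(M)\to\mathcal F_\lambda(M)$ of order at most $k$, i.e. of the $\mathbb K$-linear maps given in every chart by $A=\sum_{j\le k}a_j^{i_1\ldots i_j}\partial_{i_1}\cdots\partial_{i_j}$ with smooth $\mathbb K$-valued coefficients. $\mathrm{Vect}(M)$ acts on $\mathcal D^k_\lambda(M)$ by $\mathcal L^\lambda_X(A)=L^\lambda_X\circ A-A\circ L^\lambda_X$, and hence on the quotients $\mathcal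 D^k_\lambda(M)/\mathcal D^\ell_\lambda(M)$. Let $k>\ell\ge 0$ be integers, and let $$T:\mathcal D^k_\lambda(M)/\mathcal D^\ell_\lambda(M)\to\mathcal D^k_\mu(M)/\mathcal D^\ell_\mu(M)$$ be a $\mathbb K$-linear map that is $\mathrm{Vect}(M)$-equivariant, i.e. $T(\mathcal L^\lambda_X a)=\mathcal L^\mu_X\,T(a)$ for all $X\in\mathrm{Vect}(M)$ and all $a$. Then $T$ is local: for every open set $U\subseteq M$ and every $a\in\mathcal D^k_\lambda(M)/\mathcal D^\ell_\lambda(M)$, if $a$ vanishes on $U$ then $T(a)$ vanishes on $U$. Here the class $a$ of an operator $A\in\mathcal D^k_\lambda(M)$ is said to vanish on $U$ if the restriction of $A$ to $U$ is a differential operator of order at most $\ell$. -/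

import Mathlib

open scoped Manifold ContDiff Topology
noncomputable section
namespace DensOp

set_option linter.unusedSectionVars false

/-! ### Calculus on `ℝⁿ` -/

/-- The Euclidean space `ℝⁿ`, on which the manifolds below are modelled. -/
abbrev Eucl (n : ℕ) := EuclideanSpace ℝ (Fin n)

variable {𝕜 : Type*} [RCLike 𝕜] {n : ℕ}

/-- `|t| ^ lam` for a real number `t ≠ 0` and a real or complex exponent `lam`, with the convention
that the value at `t = 0` is `0` for every `lam`. -/
def absPow (lam : 𝕜) (t : ℝ) : 𝕜 :=
  if t = 0 then 0 else NormedSpace.exp (lam * ((Real.log |t| : ℝ) : 𝕜))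

theorem absPow_mul (lam : 𝕜) (s t : ℝ) : absPow lam (s * t) = absPow lam s * absPow lam t := by
  unfold absPow
  by_cases hs : s = 0
  · simp [hs]
  by_cases ht : t = 0
  · simp [ht]
  rw [if_neg hs, if_neg ht, if_neg (mul_ne_zero hs ht), abs_mul,
    Real.log_mul (abs_ne_zero.2 hs) (abs_ne_zero.2 ht), ← NormedSpace.exp_add]
  push_cast
  rw [mul_add]

theorem hasDerivAt_absPow (lam : 𝕜) {t : ℝ} (ht : t ≠ 0) :
    HasDerivAt (absPow lam) (absPow lam t * (lam * ((t⁻¹ : ℝ) : 𝕜))) t := by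
  have h1 : HasDerivAt (fun s : ℝ => lam * ((Real.log s : ℝ) : 𝕜)) (lam * ((t⁻¹ : ℝ) : 𝕜)) t := by
    apply HasDerivAt.const_mul
    exact (RCLike.ofRealCLM (K := 𝕜)).hasFDerivAt.comp_hasDerivAt t (Real.hasDerivAt_log ht)
  have h2 := (hasDerivAt_exp (𝕂 := 𝕜) (x := lam * ((Real.log t : ℝ) : 𝕜))).scomp_of_eq t h1 rfl
  have h3 : absPow lam t = NormedSpace.exp (lam * ((Real.log t : ℝ) : 𝕜)) := by
    simp [absPow, ht]
  rw [h3]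
  refine (h2.congr_of_eventuallyEq ?_).congr_deriv (by simp [mul_comm])
  filter_upwards [isOpen_ne.mem_nhds ht] with s hs
  have hs' : s ≠ 0 := hs
  simp [absPow, hs']

theorem clm_det_mul (A B : Eucl n →L[ℝ] Eucl n) : (A.comp B).det = A.det * B.det :=
  LinearMap.det_comp _ _

theorem contDiff_det : ContDiff ℝ ∞ (fun A : Eucl n →L[ℝ] Eucl n => A.det) := by
  have h : (fun A : Eucl n →L[ℝ] Eucl n => A.det) = fun A =>
      ∑ σ : Equiv.Perm (Fin n), (Equiv.Perm.sign σ : ℤ) • 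
        ∏ i, (A (EuclideanSpace.basisFun (Fin n) ℝ i)) (σ i) := by
    ext A
    rw [ContinuousLinearMap.det, ← LinearMap.det_toMatrix (EuclideanSpace.basisFun (Fin n) ℝ).toBasis,
      Matrix.det_apply]
    simp [LinearMap.toMatrix_apply, Units.smul_def]
  rw [h]
  refine ContDiff.sum fun σ _ => ContDiff.const_smul _ (contDiff_prod fun i _ => ?_)
  exact ((EuclideanSpace.proj (σ i) : Eucl n →L[ℝ] ℝ).comp
    (ContinuousLinearMap.apply ℝ (Eucl n) (EuclideanSpace.basisFun (Fin n) ℝ i))).contDiff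

theorem fderiv_det_id (B : Eucl n →L[ℝ] Eucl n) :
    fderiv ℝ (fun A : Eucl n →L[ℝ] Eucl n => A.det) (ContinuousLinearMap.id ℝ _) B
      = LinearMap.trace ℝ (Eucl n) B := by
  have hd : DifferentiableAt ℝ (fun A : Eucl n →L[ℝ] Eucl n => A.det)
      (ContinuousLinearMap.id ℝ _) := contDiff_det.differentiable (by simp) _
  have h1 := hd.hasFDerivAt.hasLineDerivAt B
  have h2 : HasDerivAt (fun t : ℝ => (ContinuousLinearMap.id ℝ (Eucl n) + t • B).det)
      (LinearMap.trace ℝ (Eucl n) B) 0 := by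
    let b := (EuclideanSpace.basisFun (Fin n) ℝ).toBasis
    let Q := (1 + (Polynomial.X : Polynomial ℝ) •
      (LinearMap.toMatrix b b (B : Eucl n →ₗ[ℝ] Eucl n)).map Polynomial.C).det.divX.divX
    have h3 : (fun t : ℝ => (ContinuousLinearMap.id ℝ (Eucl n) + t • B).det) = fun t =>
        1 + LinearMap.trace ℝ (Eucl n) B * t + Q.eval t * t ^ 2 := by
      ext t
      rw [ContinuousLinearMap.det, ← LinearMap.det_toMatrix b, LinearMap.trace_eq_matrix_trace ℝ b]
      rw [← Matrix.det_one_add_smul]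
      congr 1
      simp
    rw [h3]
    have h4 : HasDerivAt (fun t : ℝ => 1 + LinearMap.trace ℝ (Eucl n) B * t)
        (LinearMap.trace ℝ (Eucl n) B * 1) 0 :=
      ((hasDerivAt_id' (0 : ℝ)).const_mul (LinearMap.trace ℝ (Eucl n) B)).const_add 1
    have h5 : HasDerivAt (fun t : ℝ => Q.eval t * t ^ 2) _ 0 :=
      (Q.hasDerivAt 0).mul (hasDerivAt_pow 2 0)
    exact (h4.add h5).congr_deriv (by simp)
  exact h1.unique h2

theorem fderiv_det (A P B : Eucl n →L[ℝ] Eucl n) (h1 : A.comp P = ContinuousLinearMap.id ℝ _)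
    (h2 : P.comp A = ContinuousLinearMap.id ℝ _) :
    fderiv ℝ (fun A : Eucl n →L[ℝ] Eucl n => A.det) A B
      = A.det * LinearMap.trace ℝ (Eucl n) (P.comp B) := by
  have h3 : (fun C : Eucl n →L[ℝ] Eucl n => C.det) = fun C => A.det * (P.comp C).det := by
    ext C
    rw [← clm_det_mul, ← ContinuousLinearMap.comp_assoc, h1, ContinuousLinearMap.id_comp]
  have h4 : HasFDerivAt (fun C : Eucl n →L[ℝ] Eucl n => P.comp C)
      (ContinuousLinearMap.compL ℝ (Eucl n) (Eucl n) (Eucl n) P) A :=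
    ContinuousLinearMap.hasFDerivAt (ContinuousLinearMap.compL ℝ (Eucl n) (Eucl n) (Eucl n) P)
  have hd : DifferentiableAt ℝ (fun A : Eucl n →L[ℝ] Eucl n => A.det) (P.comp A) :=
    contDiff_det.differentiable (by simp) _
  have h5 := (hd.hasFDerivAt.comp A h4).const_mul A.det
  have h6 : HasFDerivAt (fun C : Eucl n →L[ℝ] Eucl n => A.det * (P.comp C).det) _ A := h5
  rw [h3, h6.fderiv, h2]
  simp [fderiv_det_id]

/-- The divergence `∑ i, ∂ᵢ Zⁱ` of a vector field `Z` on `ℝⁿ`, as the trace of its derivative. -/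
def divergence (Z : Eucl n → Eucl n) (y : Eucl n) : ℝ :=
  LinearMap.trace ℝ (Eucl n) (fderiv ℝ Z y)

/-- The coordinate expression `Zⁱ ∂ᵢ g + lam (∂ᵢ Zⁱ) g` of the Lie derivative of a tensor density
`g |dx¹ ∧ ⋯ ∧ dxⁿ| ^ lam` along the vector field `Z`. -/
def localLie (lam : 𝕜) (Z : Eucl n → Eucl n) (g : Eucl n → 𝕜) (y : Eucl n) : 𝕜 :=
  fderiv ℝ g y (Z y) + lam * ((divergence Z y : ℝ) : 𝕜) * g y

/-- The coordinate expression of the Lie derivative is compatible with a change of coordinates `θ`. -/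
theorem localLie_transform (lam : 𝕜) {θ : Eucl n → Eucl n} {c c' : Eucl n → 𝕜}
    {Y Z : Eucl n → Eucl n} {y : Eucl n} {P : Eucl n →L[ℝ] Eucl n}
    (hθ : ContDiffAt ℝ ∞ θ y)
    (h1 : (fderiv ℝ θ y).comp P = ContinuousLinearMap.id ℝ _)
    (h2 : P.comp (fderiv ℝ θ y) = ContinuousLinearMap.id ℝ _)
    (hc : DifferentiableAt ℝ c (θ y)) (hY : DifferentiableAt ℝ Y (θ y))
    (hZ : DifferentiableAt ℝ Z y)
    (hYZ : ∀ᶠ z in 𝓝 y, Y (θ z) = fderiv ℝ θ z (Z z))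
    (hcc : ∀ᶠ z in 𝓝 y, c' z = absPow lam (fderiv ℝ θ z).det * c (θ z)) :
    localLie lam Z c' y = absPow lam (fderiv ℝ θ y).det * localLie lam Y c (θ y) := by
  set A := fderiv ℝ θ y with hA
  have hdet : A.det ≠ 0 := by
    have := congrArg ContinuousLinearMap.det h1
    rw [clm_det_mul] at this
    intro h0
    rw [h0, zero_mul] at this
    simp [ContinuousLinearMap.det] at this
  have hθ1 : HasFDerivAt θ A y := (hθ.differentiableAt (by simp)).hasFDerivAt
  have hθ2 : HasFDerivAt (fderiv ℝ θ) (fderiv ℝ (fderiv ℝ θ) y) y :=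
    ((hθ.fderiv_right (m := 1) (by norm_cast)).differentiableAt (by simp)).hasFDerivAt
  set D2 := fderiv ℝ (fderiv ℝ θ) y with hD2
  have hsymm : ∀ v w, D2 v w = D2 w v := (hθ.isSymmSndFDerivAt (by simp; norm_cast)).eq
  -- derivative of the Jacobian determinant
  have hd : DifferentiableAt ℝ (fun A : Eucl n →L[ℝ] Eucl n => A.det) A :=
    contDiff_det.differentiable (by simp) _
  have hJ : HasFDerivAt (fun z => (fderiv ℝ θ z).det) _ y := hd.hasFDerivAt.comp y hθ2
  have hJ2 : HasFDerivAt (fun z => absPow lam (fderiv ℝ θ z).det) _ y :=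
    HasFDerivAt.comp (g := absPow lam) y (hasDerivAt_absPow lam hdet).hasFDerivAt hJ
  have hc2 : HasFDerivAt (fun z => c (θ z)) _ y := hc.hasFDerivAt.comp y hθ1
  have hprod := (hJ2.mul hc2).congr_of_eventuallyEq (f₁ := c') hcc
  -- the divergences
  have hYθ : HasFDerivAt (fun z => Y (θ z)) ((fderiv ℝ Y (θ y)).comp A) y :=
    hY.hasFDerivAt.comp y hθ1
  have hYθ2 := (hθ2.clm_apply hZ.hasFDerivAt).congr_of_eventuallyEq (f₁ := fun z => Y (θ z)) hYZ
  have hDY := hYθ.unique hYθ2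
  have hdiv : divergence Y (θ y) = divergence Z y +
      LinearMap.trace ℝ (Eucl n) (P.comp (D2 (Z y))) := by
    have e1 : fderiv ℝ Y (θ y) = (A.comp (fderiv ℝ Z y) + D2 (Z y)).comp P := by
      have : fderiv ℝ Y (θ y) = ((fderiv ℝ Y (θ y)).comp A).comp P := by
        rw [ContinuousLinearMap.comp_assoc, h1, ContinuousLinearMap.comp_id]
      rw [this, hDY]
      congr 1
      ext1 v
      simp [hsymm v (Z y), hA]
    have e2 : LinearMap.trace ℝ (Eucl n) ((A.comp (fderiv ℝ Z y) + D2 (Z y)).comp P)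
        = LinearMap.trace ℝ (Eucl n) (P.comp (A.comp (fderiv ℝ Z y) + D2 (Z y))) :=
      LinearMap.trace_comp_comm' _ _
    unfold divergence
    rw [e1, e2, ContinuousLinearMap.comp_add, ← ContinuousLinearMap.comp_assoc, h2,
      ContinuousLinearMap.id_comp]
    simp
  have hyc : c' y = absPow lam A.det * c (θ y) := hcc.self_of_nhds
  have hyY : Y (θ y) = A (Z y) := hYZ.self_of_nhds
  unfold localLie
  rw [hprod.fderiv, hyc, hdiv, hyY]
  simp only [add_apply, smul_apply,
    ContinuousLinearMap.comp_apply, fderiv_det A P _ h1 h2,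
    ContinuousLinearMap.toSpanSingleton_apply, smul_eq_mul, RCLike.real_smul_eq_coe_mul]
  have hdet' : (A.det : 𝕜) ≠ 0 := by exact_mod_cast hdet
  push_cast
  rw [← hA]
  field_simp
  ring


/-- The iterated partial derivative `∂_{I 0} ⋯ ∂_{I (j - 1)} g`. -/
def partialD {j : ℕ} (I : Fin j → Fin n) (g : Eucl n → 𝕜) (y : Eucl n) : 𝕜 :=
  iteratedFDeriv ℝ j g y (fun s => EuclideanSpace.single (I s) 1)

/-- The differential expression of order at most `k` with coefficients `a`, that is
`∑ j ≤ k, ∑ (i₁, …, iⱼ), a j (i₁, …, iⱼ) ∂_{i₁} ⋯ ∂_{iⱼ} g`. -/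
def diffExpr (k : ℕ) (a : (j : ℕ) → (Fin j → Fin n) → Eucl n → 𝕜) (g : Eucl n → 𝕜)
    (y : Eucl n) : 𝕜 :=
  ∑ j ∈ Finset.range (k + 1), ∑ I : Fin j → Fin n, a j I y * partialD I g y

/-- `P` agrees, on functions that are smooth on `Ω`, with a differential expression of order at
most `k` whose coefficients are smooth on `Ω`. Only used to prove that the Lie derivative of a
differential operator of order at most `k` is again one. -/
def IsDO (Ω : Set (Eucl n)) (k : ℕ) (P : (Eucl n → 𝕜) → Eucl n → 𝕜) : Prop :=
  ∃ a : (j : ℕ) → (Fin j → Fin n) → Eucl n → 𝕜, (∀ j I, ContDiffOn ℝ ∞ (a j I) Ω) ∧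
    ∀ g, ContDiffOn ℝ ∞ g Ω → ∀ y ∈ Ω, P g y = diffExpr k a g y

variable {Ω : Set (Eucl n)} {k : ℕ} {P Q : (Eucl n → 𝕜) → Eucl n → 𝕜}

theorem diffExpr_congr_on (hΩ : IsOpen Ω) {a : (j : ℕ) → (Fin j → Fin n) → Eucl n → 𝕜}
    {g h : Eucl n → 𝕜} (hgh : ∀ y ∈ Ω, g y = h y) {y : Eucl n} (hy : y ∈ Ω) :
    diffExpr k a g y = diffExpr k a h y := by
  have hev : g =ᶠ[𝓝 y] h := Filter.eventually_of_mem (hΩ.mem_nhds hy) hgh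
  unfold diffExpr partialD
  refine Finset.sum_congr rfl fun j _ => Finset.sum_congr rfl fun I _ => ?_
  rw [(hev.iteratedFDeriv ℝ j).eq_of_nhds]

theorem IsDO.congr (h : IsDO Ω k P)
    (hPQ : ∀ g, ContDiffOn ℝ ∞ g Ω → ∀ y ∈ Ω, Q g y = P g y) : IsDO Ω k Q := by
  obtain ⟨a, ha, h⟩ := h
  exact ⟨a, ha, fun g hg y hy => (hPQ g hg y hy).trans (h g hg y hy)⟩

theorem IsDO.zero : IsDO (𝕜 := 𝕜) Ω k (fun _ _ => 0) :=
  ⟨fun _ _ _ => 0, fun _ _ => contDiffOn_const, fun g _ y _ => by simp [diffExpr]⟩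

theorem IsDO.add (hP : IsDO Ω k P) (hQ : IsDO Ω k Q) : IsDO Ω k (fun g y => P g y + Q g y) := by
  obtain ⟨a, ha, hP⟩ := hP
  obtain ⟨b, hb, hQ⟩ := hQ
  refine ⟨fun j I y => a j I y + b j I y, fun j I => (ha j I).add (hb j I), fun g hg y hy => ?_⟩
  simp only [hP g hg y hy, hQ g hg y hy, diffExpr, add_mul, Finset.sum_add_distrib]

theorem IsDO.mul {c : Eucl n → 𝕜} (hc : ContDiffOn ℝ ∞ c Ω) (hP : IsDO Ω k P) :
    IsDO Ω k (fun g y => c y * P g y) := by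
  obtain ⟨a, ha, hP⟩ := hP
  refine ⟨fun j I y => c y * a j I y, fun j I => hc.mul (ha j I), fun g hg y hy => ?_⟩
  simp only [hP g hg y hy, diffExpr, Finset.mul_sum, mul_assoc]

theorem IsDO.sum {ι : Type*} (s : Finset ι) {R : ι → (Eucl n → 𝕜) → Eucl n → 𝕜}
    (h : ∀ i ∈ s, IsDO Ω k (R i)) : IsDO Ω k (fun g y => ∑ i ∈ s, R i g y) := by
  classical
  induction s using Finset.induction_on with
  | empty => simpa using IsDO.zero
  | insert i s hi ih =>
    simp only [Finset.sum_insert hi]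
    exact (h i (by simp)).add (ih fun j hj => h j (by simp [hj]))

theorem IsDO.mono {l : ℕ} (hkl : k ≤ l) (hP : IsDO Ω k P) : IsDO Ω l P := by
  obtain ⟨a, ha, hP⟩ := hP
  refine ⟨fun j I y => if j ≤ k then a j I y else 0, fun j I => ?_, fun g hg y hy => ?_⟩
  · by_cases h : j ≤ k
    · simpa [h] using ha j I
    · simpa [h] using contDiffOn_const
  · rw [hP g hg y hy, diffExpr, diffExpr]
    rw [← Finset.sum_subset (Finset.range_mono (Nat.succ_le_succ hkl))]
    · refine Finset.sum_congr rfl fun j hj => ?_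
      have : j ≤ k := by simpa [Nat.lt_succ_iff] using hj
      simp [this]
    · intro j _ hj
      have : ¬ j ≤ k := by simpa [Nat.lt_succ_iff] using hj
      simp [this]

theorem IsDO.of_partialD {j : ℕ} (I : Fin j → Fin n) : IsDO (𝕜 := 𝕜) Ω j (partialD I) := by
  refine ⟨fun i J _ => if h : i = j then (if J = I ∘ Fin.cast h then 1 else 0) else 0,
    fun i J => contDiffOn_const, fun g _ y _ => ?_⟩
  rw [diffExpr, Finset.sum_eq_single j]
  · simp [Fin.cast_refl]
  · intro i _ hi
    simp [hi]
  · intro h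
    simp at h

theorem partialD_zero (I : Fin 0 → Fin n) (g : Eucl n → 𝕜) (y : Eucl n) :
    partialD I g y = g y := rfl

theorem contDiffOn_partialD (hΩ : IsOpen Ω) {j : ℕ} (I : Fin j → Fin n) {g : Eucl n → 𝕜}
    (hg : ContDiffOn ℝ ∞ g Ω) : ContDiffOn ℝ ∞ (partialD I g) Ω := by
  intro y hy
  have h := (hg.contDiffAt (hΩ.mem_nhds hy)).iteratedFDeriv_right (m := ∞) (i := j) (by norm_cast)
  have h2 := (ContinuousMultilinearMap.apply ℝ (fun _ : Fin j => Eucl n) 𝕜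
    (fun s => EuclideanSpace.single (I s) 1)).contDiff (n := ∞) |>.contDiffAt.comp y h
  exact h2.contDiffWithinAt

theorem partialD_cons (hΩ : IsOpen Ω) {j : ℕ} (i : Fin n) (I : Fin j → Fin n) {g : Eucl n → 𝕜}
    (hg : ContDiffOn ℝ ∞ g Ω) {y : Eucl n} (hy : y ∈ Ω) :
    partialD (Fin.cons i I : Fin (j + 1) → Fin n) g y =
      fderiv ℝ (partialD I g) y (EuclideanSpace.single i 1) := by
  have h := ((hg.contDiffAt (hΩ.mem_nhds hy)).iteratedFDeriv_right (m := ∞) (i := j)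
    (by norm_cast)).differentiableAt (by simp)
  have h2 := (ContinuousMultilinearMap.apply ℝ (fun _ : Fin j => Eucl n) 𝕜
    (fun s => EuclideanSpace.single (I s) 1)).hasFDerivAt.comp y h.hasFDerivAt
  have h3 : HasFDerivAt (partialD I g) _ y := h2
  rw [h3.fderiv]
  simp only [partialD, iteratedFDeriv_succ_apply_left]
  simp [Fin.tail_def]

theorem contDiffOn_diffExpr (hΩ : IsOpen Ω) {a : (j : ℕ) → (Fin j → Fin n) → Eucl n → 𝕜}
    (ha : ∀ j I, ContDiffOn ℝ ∞ (a j I) Ω) {g : Eucl n → 𝕜} (hg : ContDiffOn ℝ ∞ g Ω) :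
    ContDiffOn ℝ ∞ (diffExpr k a g) Ω :=
  ContDiffOn.sum fun j _ => ContDiffOn.sum fun I _ => (ha j I).mul (contDiffOn_partialD hΩ I hg)

theorem IsDO.contDiffOn (hΩ : IsOpen Ω) (hP : IsDO Ω k P) {g : Eucl n → 𝕜}
    (hg : ContDiffOn ℝ ∞ g Ω) : ContDiffOn ℝ ∞ (P g) Ω := by
  obtain ⟨a, ha, hP⟩ := hP
  exact (contDiffOn_diffExpr hΩ ha hg).congr fun y hy => hP g hg y hy

theorem contDiffOn_fderiv_apply (hΩ : IsOpen Ω) {F : Type*} [NormedAddCommGroup F]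
    [NormedSpace ℝ F] {g : Eucl n → F} (hg : ContDiffOn ℝ ∞ g Ω)
    {Z : Eucl n → Eucl n} (hZ : ContDiffOn ℝ ∞ Z Ω) :
    ContDiffOn ℝ ∞ (fun y => fderiv ℝ g y (Z y)) Ω :=
  (hg.fderiv_of_isOpen hΩ (by norm_cast)).clm_apply hZ

/-- Derivative of a product on functions smooth on an open set. -/
theorem fderiv_mul_apply' {c g : Eucl n → 𝕜} {y : Eucl n} (hc : DifferentiableAt ℝ c y)
    (hg : DifferentiableAt ℝ g y) (v : Eucl n) :
    fderiv ℝ (fun z => c z * g z) y v = c y * fderiv ℝ g y v + fderiv ℝ c y v * g y := by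
  rw [fderiv_fun_mul hc hg]
  simp [mul_comm]

theorem diffAt (hΩ : IsOpen Ω) {F : Type*} [NormedAddCommGroup F]
    [NormedSpace ℝ F] {g : Eucl n → F} (hg : ContDiffOn ℝ ∞ g Ω) {y : Eucl n} (hy : y ∈ Ω) :
    DifferentiableAt ℝ g y :=
  (hg.contDiffAt (hΩ.mem_nhds hy)).differentiableAt (by simp)

theorem fderiv_congr_on (hΩ : IsOpen Ω) {F : Type*} [NormedAddCommGroup F]
    [NormedSpace ℝ F] {g h : Eucl n → F} (hgh : ∀ y ∈ Ω, g y = h y) {y : Eucl n} (hy : y ∈ Ω) :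
    fderiv ℝ g y = fderiv ℝ h y :=
  Filter.EventuallyEq.fderiv_eq (Filter.eventually_of_mem (hΩ.mem_nhds hy) hgh)

theorem fderiv_diffExpr (hΩ : IsOpen Ω) {a : (j : ℕ) → (Fin j → Fin n) → Eucl n → 𝕜}
    (ha : ∀ j I, ContDiffOn ℝ ∞ (a j I) Ω) {g : Eucl n → 𝕜} (hg : ContDiffOn ℝ ∞ g Ω)
    {y : Eucl n} (hy : y ∈ Ω) (v : Eucl n) :
    fderiv ℝ (diffExpr k a g) y v = ∑ j ∈ Finset.range (k + 1), ∑ I : Fin j → Fin n,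
      (a j I y * fderiv ℝ (partialD I g) y v + fderiv ℝ (a j I) y v * partialD I g y) := by
  have hd : ∀ j (I : Fin j → Fin n),
      DifferentiableAt ℝ (fun z => a j I z * partialD I g z) y := fun j I =>
    (diffAt hΩ (ha j I) hy).mul (diffAt hΩ (contDiffOn_partialD hΩ I hg) hy)
  unfold diffExpr
  rw [fderiv_fun_sum fun j _ => DifferentiableAt.fun_sum fun I _ => hd j I, sum_apply]
  refine Finset.sum_congr rfl fun j _ => ?_
  rw [fderiv_fun_sum fun I _ => hd j I, sum_apply]
  refine Finset.sum_congr rfl fun I _ => ?_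
  exact fderiv_mul_apply' (diffAt hΩ (ha j I) hy) (diffAt hΩ (contDiffOn_partialD hΩ I hg) hy) v

theorem IsDO.comp_left (hΩ : IsOpen Ω) (hP : IsDO Ω k P) (i : Fin n) :
    IsDO Ω (k + 1) (fun g y => fderiv ℝ (P g) y (EuclideanSpace.single i 1)) := by
  obtain ⟨a, ha, hP⟩ := hP
  have key : IsDO (𝕜 := 𝕜) Ω (k + 1) (fun g y => ∑ j ∈ Finset.range (k + 1), ∑ I : Fin j → Fin n,
      (a j I y * partialD (Fin.cons i I : Fin (j + 1) → Fin n) g y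
        + fderiv ℝ (a j I) y (EuclideanSpace.single i 1) * partialD I g y)) := by
    refine IsDO.sum _ fun j hj => IsDO.sum _ fun I _ => ?_
    have hj' : j ≤ k := by simpa [Nat.lt_succ_iff] using hj
    refine IsDO.add ?_ ?_
    · exact ((IsDO.of_partialD _).mul (ha j I)).mono (by omega)
    · exact ((IsDO.of_partialD I).mul (contDiffOn_fderiv_apply hΩ (ha j I) contDiffOn_const)).mono
        (by omega)
  refine key.congr fun g hg y hy => ?_
  rw [fderiv_congr_on hΩ (hP g hg) hy, fderiv_diffExpr hΩ ha hg hy]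
  refine Finset.sum_congr rfl fun j _ => Finset.sum_congr rfl fun I _ => ?_
  rw [partialD_cons hΩ i I hg hy]

theorem contDiffOn_divergence (hΩ : IsOpen Ω) {Z : Eucl n → Eucl n} (hZ : ContDiffOn ℝ ∞ Z Ω) :
    ContDiffOn ℝ ∞ (divergence Z) Ω := by
  have h := hZ.fderiv_of_isOpen (m := ∞) hΩ (by norm_cast)
  let L : (Eucl n →L[ℝ] Eucl n) →ₗ[ℝ] ℝ :=
    (LinearMap.trace ℝ (Eucl n)).comp (ContinuousLinearMap.coeLM ℝ)
  exact (LinearMap.toContinuousLinearMap L).contDiff.comp_contDiffOn h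

theorem contDiffOn_ofReal {r : Eucl n → ℝ} (hr : ContDiffOn ℝ ∞ r Ω) :
    ContDiffOn ℝ ∞ (fun y => ((r y : ℝ) : 𝕜)) Ω :=
  (RCLike.ofRealCLM (K := 𝕜)).contDiff.comp_contDiffOn hr

theorem contDiffOn_localLie (hΩ : IsOpen Ω) (lam : 𝕜) {Z : Eucl n → Eucl n}
    (hZ : ContDiffOn ℝ ∞ Z Ω) {g : Eucl n → 𝕜} (hg : ContDiffOn ℝ ∞ g Ω) :
    ContDiffOn ℝ ∞ (localLie lam Z g) Ω :=
  (contDiffOn_fderiv_apply hΩ hg hZ).add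
    ((contDiffOn_const.mul (contDiffOn_ofReal (contDiffOn_divergence hΩ hZ))).mul hg)

theorem localLie_congr_on (hΩ : IsOpen Ω) (lam : 𝕜) (Z : Eucl n → Eucl n) {g h : Eucl n → 𝕜}
    (hgh : ∀ y ∈ Ω, g y = h y) {y : Eucl n} (hy : y ∈ Ω) :
    localLie lam Z g y = localLie lam Z h y := by
  rw [localLie, localLie, fderiv_congr_on hΩ hgh hy, hgh y hy]

theorem localLie_comm_fderiv (hΩ : IsOpen Ω) (lam : 𝕜) {Z : Eucl n → Eucl n}
    (hZ : ContDiffOn ℝ ∞ Z Ω) {h : Eucl n → 𝕜} (hh : ContDiffOn ℝ ∞ h Ω) (v : Eucl n)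
    {y : Eucl n} (hy : y ∈ Ω) :
    localLie lam Z (fun z => fderiv ℝ h z v) y - fderiv ℝ (localLie lam Z h) y v =
      -(fderiv ℝ h y (fderiv ℝ Z y v) +
        lam * fderiv ℝ (fun z => ((divergence Z z : ℝ) : 𝕜)) y v * h y) := by
  have hdh : DifferentiableAt ℝ h y := diffAt hΩ hh hy
  have hd2 : HasFDerivAt (fderiv ℝ h) (fderiv ℝ (fderiv ℝ h) y) y :=
    (diffAt hΩ (hh.fderiv_of_isOpen (m := ∞) hΩ (by norm_cast)) hy).hasFDerivAt
  have hdZ : HasFDerivAt Z (fderiv ℝ Z y) y := (diffAt hΩ hZ hy).hasFDerivAt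
  have hdd := (diffAt hΩ (contDiffOn_ofReal (𝕜 := 𝕜) (contDiffOn_divergence hΩ hZ)) hy).hasFDerivAt
  have hsymm := ((hh.contDiffAt (hΩ.mem_nhds hy)).isSymmSndFDerivAt (by simp; norm_cast)).eq
  have e1 : HasFDerivAt (fun z => fderiv ℝ h z v) _ y := hd2.clm_apply (hasFDerivAt_const v y)
  have e2 : HasFDerivAt (localLie lam Z h) _ y :=
    (hd2.clm_apply hdZ).add ((hdd.const_mul lam).mul hdh.hasFDerivAt)
  rw [e2.fderiv, localLie, e1.fderiv]
  simp [hsymm v (Z y)]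
  ring

theorem fderiv_apply_eq_sum (g : Eucl n → 𝕜) (y v : Eucl n) :
    fderiv ℝ g y v = ∑ m, ((v m : ℝ) : 𝕜) * fderiv ℝ g y (EuclideanSpace.single m 1) := by
  conv_lhs => rw [← (EuclideanSpace.basisFun (Fin n) ℝ).sum_repr v]
  simp [map_sum, RCLike.real_smul_eq_coe_mul]

theorem IsDO.comm_partialD (hΩ : IsOpen Ω) (lam : 𝕜) {Z : Eucl n → Eucl n}
    (hZ : ContDiffOn ℝ ∞ Z Ω) {j : ℕ} (I : Fin j → Fin n) :
    IsDO Ω j (fun g y => localLie lam Z (partialD I g) y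
      - partialD I (localLie lam Z g) y) := by
  induction j with
  | zero => exact IsDO.zero.congr fun g _ y _ => sub_self _
  | succ j ih =>
    obtain ⟨i, I, rfl⟩ : ∃ i J, I = Fin.cons i J := ⟨I 0, Fin.tail I, (Fin.cons_self_tail I).symm⟩
    have hdZ : ∀ m, ContDiffOn ℝ ∞ (fun y =>
        (((fderiv ℝ Z y (EuclideanSpace.single i 1)) m : ℝ) : 𝕜)) Ω := fun m =>
      contDiffOn_ofReal ((EuclideanSpace.proj (𝕜 := ℝ) m).contDiff.comp_contDiffOn
        (contDiffOn_fderiv_apply hΩ hZ contDiffOn_const))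
    have key := (((IsDO.sum (Finset.univ : Finset (Fin n)) fun m _ =>
        (IsDO.of_partialD (𝕜 := 𝕜) (Ω := Ω) (Fin.cons m I : Fin (j + 1) → Fin n)).mul (hdZ m)).add
      (((IsDO.of_partialD I).mono (Nat.le_succ j)).mul (contDiffOn_const.mul (contDiffOn_fderiv_apply
        hΩ (contDiffOn_ofReal (𝕜 := 𝕜) (contDiffOn_divergence hΩ hZ))
          contDiffOn_const) : ContDiffOn ℝ ∞ (fun y => lam * fderiv ℝ
            (fun z => ((divergence Z z : ℝ) : 𝕜)) y (EuclideanSpace.single i 1)) Ω))).mul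
      (contDiffOn_const (c := (-1 : 𝕜)))).add ((ih I).comp_left hΩ i)
    refine key.congr fun g hg y hy => ?_
    have hI := contDiffOn_partialD hΩ I hg
    have hL := contDiffOn_localLie hΩ lam hZ hg
    have e1 := localLie_comm_fderiv hΩ lam hZ hI (EuclideanSpace.single i 1) hy
    have e2 : fderiv ℝ (fun z => localLie lam Z (partialD I g) z
        - partialD I (localLie lam Z g) z) y =
        fderiv ℝ (localLie lam Z (partialD I g)) y
          - fderiv ℝ (partialD I (localLie lam Z g)) y :=
      fderiv_fun_sub (diffAt hΩ (contDiffOn_localLie hΩ lam hZ hI) hy)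
        (diffAt hΩ (contDiffOn_partialD hΩ I hL) hy)
    rw [localLie_congr_on hΩ lam Z (fun z hz => partialD_cons hΩ i I hg hz) hy,
      partialD_cons hΩ i I hL hy, e2, sub_apply]
    rw [fderiv_apply_eq_sum _ _ (fderiv ℝ Z y (EuclideanSpace.single i 1))] at e1
    simp only [partialD_cons hΩ _ I hg hy]
    linear_combination e1

theorem IsDO.comm (hΩ : IsOpen Ω) (lam : 𝕜) {Z : Eucl n → Eucl n}
    (hZ : ContDiffOn ℝ ∞ Z Ω) (hP : IsDO Ω k P) :
    IsDO Ω k (fun g y => localLie lam Z (P g) y - P (localLie lam Z g) y) := by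
  obtain ⟨a, ha, hP⟩ := hP
  have key : IsDO Ω k (fun g y => ∑ j ∈ Finset.range (k + 1), ∑ I : Fin j → Fin n,
      (fderiv ℝ (a j I) y (Z y) * partialD I g y
        + a j I y * (localLie lam Z (partialD I g) y
          - partialD I (localLie lam Z g) y))) := by
    refine IsDO.sum _ fun j hj => IsDO.sum _ fun I _ => ?_
    have hj' : j ≤ k := by simpa [Nat.lt_succ_iff] using hj
    refine IsDO.mono hj' (IsDO.add ?_ ?_)
    · exact (IsDO.of_partialD I).mul (contDiffOn_fderiv_apply hΩ (ha j I) hZ)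
    · exact (IsDO.comm_partialD hΩ lam hZ I).mul (ha j I)
  refine key.congr fun g hg y hy => ?_
  rw [localLie_congr_on hΩ lam Z (hP g hg) hy, hP _ (contDiffOn_localLie hΩ lam hZ hg) y hy,
    localLie, fderiv_diffExpr hΩ ha hg hy]
  simp only [diffExpr, Finset.mul_sum, ← Finset.sum_add_distrib, ← Finset.sum_sub_distrib]
  refine Finset.sum_congr rfl fun j _ => Finset.sum_congr rfl fun I _ => ?_
  simp only [localLie]
  ring


/-! ### Tensor densities on a manifold -/

variable {M : Type*} [TopologicalSpace M] [ChartedSpace (Eucl n) M]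

/-- The smooth vector fields `Vect(M)` on the smooth `n`-dimensional manifold `M`. -/
abbrev VectorFields (n : ℕ) (M : Type*) [TopologicalSpace M] [ChartedSpace (Eucl n) M]
    [IsManifold (𝓡 n) ∞ M] :=
  ContMDiffSection (𝓡 n) (Eucl n) ∞ (TangentSpace (𝓡 n) : M → Type)

/-- The coordinate frame of the chart `e` at the point with coordinates `y`: the linear map
`ℝⁿ → T_x M`, `x = e.symm y`, that takes the standard basis to `∂/∂x¹, …, ∂/∂xⁿ`. -/
def chartFrame (e : OpenPartialHomeomorph M (Eucl n)) (y : Eucl n) :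
    Eucl n →L[ℝ] TangentSpace (𝓡 n) (e.symm y) :=
  mfderiv (𝓡 n) (𝓡 n) e.symm y

/-- The differential `T_x M → ℝⁿ` of the chart `e` at `x`. -/
def chartCoframe (e : OpenPartialHomeomorph M (Eucl n)) (x : M) :
    TangentSpace (𝓡 n) x →L[ℝ] Eucl n :=
  mfderiv (𝓡 n) (𝓡 n) e x

/-- The coordinate expression of a family `φ` of functions of frames in the chart `e`: its value on
the coordinate frame, as a function of the coordinates `y`. -/
def coeff (e : OpenPartialHomeomorph M (Eucl n))
    (φ : (x : M) → (Eucl n →L[ℝ] TangentSpace (𝓡 n) x) → 𝕜) (y : Eucl n) : 𝕜 :=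
  φ (e.symm y) (chartFrame e y)

/-- The coordinate expression of a vector field in the chart `e`. -/
def chartVF (e : OpenPartialHomeomorph M (Eucl n)) (X : (x : M) → TangentSpace (𝓡 n) x)
    (y : Eucl n) : Eucl n :=
  chartCoframe e (e.symm y) (X (e.symm y))

/-- The space of (smooth, real or complex valued) tensor densities of degree `lam` on `M`, that is
of smooth sections of the line bundle `|Λⁿ T*M| ^ lam`. A frame at `x` is a linear isomorphism
`f : ℝⁿ → T_x M`, and an element of the fibre at `x` is a function `φ x` of frames such that
`φ x (f ∘ A) = |det A| ^ lam * φ x f` for every linear automorphism `A` of `ℝⁿ`. To have a total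
function, `φ x` is extended by `0` to the linear maps `ℝⁿ → T_x M` that are not invertible; as
`absPow lam 0 = 0`, this amounts to imposing the same law for every linear map `A`. Smoothness
means that the coordinate expression in each chart is smooth. -/
def tensorDensity (n : ℕ) (M : Type*) [TopologicalSpace M] [ChartedSpace (Eucl n) M] (lam : 𝕜) :
    Submodule 𝕜 ((x : M) → (Eucl n →L[ℝ] TangentSpace (𝓡 n) x) → 𝕜) where
  carrier := {φ | (∀ x f (A : Eucl n →L[ℝ] Eucl n), φ x (f.comp A) = absPow lam A.det * φ x f) ∧
    ∀ e ∈ IsManifold.maximalAtlas (𝓡 n) ∞ M, ContDiffOn ℝ ∞ (coeff e φ) e.target}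
  zero_mem' := ⟨fun x f A => by simp, fun e _ => contDiffOn_const⟩
  add_mem' {φ ψ} hφ hψ := ⟨fun x f A => by simp [hφ.1 x f A, hψ.1 x f A, mul_add],
    fun e he => (hφ.2 e he).add (hψ.2 e he)⟩
  smul_mem' c φ hφ := ⟨fun x f A => by simp [hφ.1 x f A, mul_left_comm],
    fun e he => contDiffOn_const.mul (hφ.2 e he)⟩

/-- The space `F_lam(M)` of tensor densities of degree `lam` on `M`, as a type. -/
def DensitySpace (n : ℕ) (M : Type*) [TopologicalSpace M] [ChartedSpace (Eucl n) M] (lam : 𝕜) :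
    Type _ :=
  tensorDensity n M lam

instance (lam : 𝕜) : AddCommGroup (DensitySpace n M lam) :=
  inferInstanceAs (AddCommGroup (tensorDensity n M lam))

instance (lam : 𝕜) : Module 𝕜 (DensitySpace n M lam) :=
  inferInstanceAs (Module 𝕜 (tensorDensity n M lam))

section Transition

variable [IsManifold (𝓡 n) ∞ M] {e e' : OpenPartialHomeomorph M (Eucl n)}

theorem mdifferentiable_of_mem (he : e ∈ IsManifold.maximalAtlas (𝓡 n) ∞ M) :
    e.MDifferentiable (𝓡 n) (𝓡 n) :=
  ⟨(contMDiffOn_of_mem_maximalAtlas he).mdifferentiableOn (by simp),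
    (contMDiffOn_symm_of_mem_maximalAtlas he).mdifferentiableOn (by simp)⟩

theorem coframe_comp_frame (he : e ∈ IsManifold.maximalAtlas (𝓡 n) ∞ M) {y : Eucl n}
    (hy : y ∈ e.target) :
    (chartCoframe e (e.symm y)).comp (chartFrame e y) = ContinuousLinearMap.id ℝ _ :=
  (mdifferentiable_of_mem he).comp_symm_deriv hy

theorem frame_comp_coframe (he : e ∈ IsManifold.maximalAtlas (𝓡 n) ∞ M) {y : Eucl n}
    (hy : y ∈ e.target) :
    (chartFrame e y).comp (chartCoframe e (e.symm y)) = ContinuousLinearMap.id ℝ _ := by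
  have h := (mdifferentiable_of_mem he).symm_comp_deriv (e.map_target hy)
  rw [e.right_inv hy] at h
  exact h

theorem contDiffOn_chartVF (he : e ∈ IsManifold.maximalAtlas (𝓡 n) ∞ M) (X : VectorFields n M) :
    ContDiffOn ℝ ∞ (chartVF e X) e.target := by
  intro y hy
  have hinv : (mfderiv (𝓡 n) (𝓡 n) e.symm y).IsInvertible :=
    ContinuousLinearMap.IsInvertible.of_inverse (frame_comp_coframe he hy)
      (coframe_comp_frame he hy)
  have h1 : ContMDiffAt (𝓡 n) (𝓡 n).tangent ∞
      (fun y => (⟨y, VectorField.mpullback (𝓡 n) (𝓡 n) e.symm X y⟩ : TangentBundle (𝓡 n) (Eucl n))) y :=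
    ContMDiffAt.mpullback_vectorField_preimage (X.contMDiff _)
      (contMDiffAt_symm_of_mem_maximalAtlas he hy) hinv (by simp)
  have h2 := contMDiffAt_vectorSpace_iff_contDiffAt.1 h1
  refine (h2.congr_of_eventuallyEq ?_).contDiffWithinAt
  filter_upwards [e.open_target.mem_nhds hy] with z hz
  rw [VectorField.mpullback_apply]
  have : (mfderiv (𝓡 n) (𝓡 n) e.symm z).inverse = chartCoframe e (e.symm z) :=
    ContinuousLinearMap.inverse_eq (frame_comp_coframe he hz) (coframe_comp_frame he hz)
  rw [this]
  rfl

theorem contDiffAt_transition (he : e ∈ IsManifold.maximalAtlas (𝓡 n) ∞ M)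
    (he' : e' ∈ IsManifold.maximalAtlas (𝓡 n) ∞ M) {y : Eucl n} (hy : y ∈ e'.target)
    (hy' : e'.symm y ∈ e.source) : ContDiffAt ℝ ∞ (fun z => e (e'.symm z)) y :=
  contMDiffAt_iff_contDiffAt.1 ((contMDiffAt_of_mem_maximalAtlas he hy').comp y
    (contMDiffAt_symm_of_mem_maximalAtlas he' hy))

theorem fderiv_transition (he : e ∈ IsManifold.maximalAtlas (𝓡 n) ∞ M)
    (he' : e' ∈ IsManifold.maximalAtlas (𝓡 n) ∞ M) {y : Eucl n} (hy : y ∈ e'.target)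
    (hy' : e'.symm y ∈ e.source) :
    fderiv ℝ (fun z => e (e'.symm z)) y = (chartCoframe e (e'.symm y)).comp (chartFrame e' y) := by
  rw [← mfderiv_eq_fderiv]
  exact mfderiv_comp y ((mdifferentiable_of_mem he).mdifferentiableAt hy')
    ((mdifferentiable_of_mem he').mdifferentiableAt_symm hy)

theorem apply_frame_congr (φ : (x : M) → (Eucl n →L[ℝ] TangentSpace (𝓡 n) x) → 𝕜) {x x' : M}
    (h : x = x') (f : Eucl n →L[ℝ] Eucl n) : φ x f = φ x' f := by
  subst h; rfl

theorem coframe_comp_frame' (he : e ∈ IsManifold.maximalAtlas (𝓡 n) ∞ M) {x : M}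
    (hx : x ∈ e.source) :
    (chartFrame e (e x) : Eucl n →L[ℝ] Eucl n).comp (chartCoframe e x : Eucl n →L[ℝ] Eucl n)
      = ContinuousLinearMap.id ℝ _ :=
  (mdifferentiable_of_mem he).symm_comp_deriv hx

/-- The transformation law of the coordinate expression of a tensor density. -/
theorem coeff_transition {lam : 𝕜} {φ : (x : M) → (Eucl n →L[ℝ] TangentSpace (𝓡 n) x) → 𝕜}
    (hφ : φ ∈ tensorDensity n M lam) (he : e ∈ IsManifold.maximalAtlas (𝓡 n) ∞ M)
    (he' : e' ∈ IsManifold.maximalAtlas (𝓡 n) ∞ M) {y : Eucl n} (hy : y ∈ e'.target)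
    (hy' : e'.symm y ∈ e.source) :
    coeff e' φ y =
      absPow lam (fderiv ℝ (fun z => e (e'.symm z)) y).det * coeff e φ (e (e'.symm y)) := by
  rw [coeff, coeff, ← hφ.1, fderiv_transition he he' hy hy']
  refine (apply_frame_congr φ (e.left_inv hy').symm (chartFrame e' y)).trans ?_
  congr 1
  have h := coframe_comp_frame' he hy'
  rw [← ContinuousLinearMap.comp_assoc]
  exact (congrArg (fun B : Eucl n →L[ℝ] Eucl n => B.comp (chartFrame e' y)) h).symm

theorem chartVF_transition (he : e ∈ IsManifold.maximalAtlas (𝓡 n) ∞ M)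
    (he' : e' ∈ IsManifold.maximalAtlas (𝓡 n) ∞ M) (X : (x : M) → TangentSpace (𝓡 n) x)
    {y : Eucl n} (hy : y ∈ e'.target)
    (hy' : e'.symm y ∈ e.source) :
    chartVF e X (e (e'.symm y)) = fderiv ℝ (fun z => e (e'.symm z)) y (chartVF e' X y) := by
  have h : chartFrame e' y (chartCoframe e' (e'.symm y) (X (e'.symm y))) = X (e'.symm y) :=
    DFunLike.congr_fun (frame_comp_coframe he' hy) (X (e'.symm y))
  rw [fderiv_transition he he' hy hy', chartVF, chartVF, ContinuousLinearMap.comp_apply, h,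
    e.left_inv hy']

end Transition

/-- The Lie derivative of a tensor density `φ` along `X`: at `x` it is the density whose
coordinate expression is `Xⁱ ∂ᵢ φ + lam (∂ᵢ Xⁱ) φ` in the preferred chart at `x`. That the same
expression then holds in every chart is `coeff_lieDerivFun`. -/
def lieDerivFun (lam : 𝕜) (X : (x : M) → TangentSpace (𝓡 n) x)
    (φ : (x : M) → (Eucl n →L[ℝ] TangentSpace (𝓡 n) x) → 𝕜) (x : M)
    (f : Eucl n →L[ℝ] TangentSpace (𝓡 n) x) : 𝕜 :=
  absPow lam ((chartCoframe (chartAt (Eucl n) x) x).comp f).det *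
    localLie lam (chartVF (chartAt (Eucl n) x) X) (coeff (chartAt (Eucl n) x) φ)
      (chartAt (Eucl n) x x)

section Lie

variable [IsManifold (𝓡 n) ∞ M] {e : OpenPartialHomeomorph M (Eucl n)}

/-- In every chart, the Lie derivative has the coordinate expression
`Xⁱ ∂ᵢ φ + lam (∂ᵢ Xⁱ) φ`. -/
theorem coeff_lieDerivFun {lam : 𝕜} {φ : (x : M) → (Eucl n →L[ℝ] TangentSpace (𝓡 n) x) → 𝕜}
    (hφ : φ ∈ tensorDensity n M lam) (X : VectorFields n M)
    (he : e ∈ IsManifold.maximalAtlas (𝓡 n) ∞ M) {y : Eucl n} (hy : y ∈ e.target) :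
    coeff e (lieDerivFun lam X φ) y = localLie lam (chartVF e X) (coeff e φ) y := by
  set c := chartAt (Eucl n) (e.symm y) with hc
  have hcm : c ∈ IsManifold.maximalAtlas (𝓡 n) ∞ M := IsManifold.chart_mem_maximalAtlas _
  have hy' : e.symm y ∈ c.source := mem_chart_source _ _
  have hct : c (e.symm y) ∈ c.target := c.map_source hy'
  have hnear : ∀ᶠ z in 𝓝 y, z ∈ e.target ∧ e.symm z ∈ c.source :=
    (e.isOpen_inter_preimage_symm c.open_source).mem_nhds ⟨hy, hy'⟩
  have key := localLie_transform lam (θ := fun z => c (e.symm z)) (c := coeff c φ)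
    (c' := coeff e φ) (Y := chartVF c X) (Z := chartVF e X) (y := y)
    (P := (chartCoframe e (e.symm y) : Eucl n →L[ℝ] Eucl n).comp
      (chartFrame c (c (e.symm y)) : Eucl n →L[ℝ] Eucl n))
    (contDiffAt_transition hcm he hy hy') ?_ ?_
    (diffAt c.open_target (hφ.2 c hcm) hct)
    (diffAt c.open_target (contDiffOn_chartVF hcm X) hct)
    (diffAt e.open_target (contDiffOn_chartVF he X) hy)
    (hnear.mono fun z hz => chartVF_transition hcm he X hz.1 hz.2)
    (hnear.mono fun z hz => coeff_transition hφ hcm he hz.1 hz.2)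
  · rw [key, fderiv_transition hcm he hy hy']
    rfl
  · rw [fderiv_transition hcm he hy hy']
    have h1 : (chartFrame e y : Eucl n →L[ℝ] Eucl n).comp
        (chartCoframe e (e.symm y) : Eucl n →L[ℝ] Eucl n) = ContinuousLinearMap.id ℝ _ :=
      frame_comp_coframe he hy
    have h2 : (chartCoframe c (e.symm y) : Eucl n →L[ℝ] Eucl n).comp
        (chartFrame c (c (e.symm y)) : Eucl n →L[ℝ] Eucl n) = ContinuousLinearMap.id ℝ _ := by
      have h3 := coframe_comp_frame hcm hct
      rw [c.left_inv hy'] at h3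
      exact h3
    ext1 v
    have h1' := DFunLike.congr_fun h1 ((chartFrame c (c (e.symm y)) : Eucl n →L[ℝ] Eucl n) v)
    exact (congrArg (chartCoframe c (e.symm y) : Eucl n →L[ℝ] Eucl n) h1').trans
      (DFunLike.congr_fun h2 v)
  · rw [fderiv_transition hcm he hy hy']
    have h1 := coframe_comp_frame he hy
    have h2 := coframe_comp_frame' hcm hy'
    ext1 v
    have h2' := DFunLike.congr_fun h2 ((chartFrame e y : Eucl n →L[ℝ] Eucl n) v)
    exact (congrArg (chartCoframe e (e.symm y) : Eucl n →L[ℝ] Eucl n) h2').trans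
      (DFunLike.congr_fun h1 v)

theorem lieDerivFun_mem {lam : 𝕜} {φ : (x : M) → (Eucl n →L[ℝ] TangentSpace (𝓡 n) x) → 𝕜}
    (hφ : φ ∈ tensorDensity n M lam) (X : VectorFields n M) :
    lieDerivFun lam X φ ∈ tensorDensity n M lam := by
  refine ⟨fun x f A => ?_, fun e he => ?_⟩
  · unfold lieDerivFun
    rw [← ContinuousLinearMap.comp_assoc, clm_det_mul, absPow_mul]
    ring
  · exact (contDiffOn_localLie e.open_target lam (contDiffOn_chartVF he X) (hφ.2 e he)).congr
      fun y hy => coeff_lieDerivFun hφ X he hy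

end Lie

/-! ### Differential operators -/

section Operators

variable [IsManifold (𝓡 n) ∞ M]

theorem localLie_add (lam : 𝕜) (Z : Eucl n → Eucl n) {g h : Eucl n → 𝕜} {y : Eucl n}
    (hg : DifferentiableAt ℝ g y) (hh : DifferentiableAt ℝ h y) :
    localLie lam Z (g + h) y = localLie lam Z g y + localLie lam Z h y := by
  simp only [localLie, fderiv_add hg hh, add_apply, Pi.add_apply]
  ring

theorem localLie_smul (lam : 𝕜) (Z : Eucl n → Eucl n) (c : 𝕜) {g : Eucl n → 𝕜} {y : Eucl n}
    (hg : DifferentiableAt ℝ g y) :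
    localLie lam Z (c • g) y = c * localLie lam Z g y := by
  simp only [localLie, fderiv_const_smul hg, smul_apply, Pi.smul_apply, smul_eq_mul]
  ring

theorem differentiableAt_coeff_chartAt {lam : 𝕜} (φ : DensitySpace n M lam) (x : M) :
    DifferentiableAt ℝ (coeff (chartAt (Eucl n) x) φ.1) (chartAt (Eucl n) x x) :=
  diffAt (chartAt (Eucl n) x).open_target (φ.2.2 _ (IsManifold.chart_mem_maximalAtlas x))
    ((chartAt (Eucl n) x).map_source (mem_chart_source _ x))

/-- The Lie derivative along `X` as a linear endomorphism of the space of tensor densities of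
degree `lam`. -/
def lieDeriv (lam : 𝕜) (X : VectorFields n M) :
    DensitySpace n M lam →ₗ[𝕜] DensitySpace n M lam where
  toFun φ := ⟨lieDerivFun lam X φ.1, lieDerivFun_mem φ.2 X⟩
  map_add' φ ψ := by
    refine Subtype.ext (funext fun x => funext fun f => ?_)
    change absPow lam _ * localLie lam _ (coeff _ φ.1 + coeff _ ψ.1) _ =
      absPow lam _ * localLie lam _ (coeff _ φ.1) _ + absPow lam _ * localLie lam _ (coeff _ ψ.1) _
    rw [localLie_add _ _ (differentiableAt_coeff_chartAt φ x) (differentiableAt_coeff_chartAt ψ x),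
      mul_add]
  map_smul' c φ := by
    refine Subtype.ext (funext fun x => funext fun f => ?_)
    change absPow lam _ * localLie lam _ (c • coeff _ φ.1) _ =
      c * (absPow lam _ * localLie lam _ (coeff _ φ.1) _)
    rw [localLie_smul _ _ _ (differentiableAt_coeff_chartAt φ x), mul_left_comm]

/-- The action `A ↦ L_X ∘ A - A ∘ L_X` of a vector field `X` on the linear endomorphisms `A` of the
space of tensor densities of degree `lam`. -/
def lieOp (lam : 𝕜) (X : VectorFields n M) :
    Module.End 𝕜 (DensitySpace n M lam) →ₗ[𝕜] Module.End 𝕜 (DensitySpace n M lam) where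
  toFun A := lieDeriv lam X ∘ₗ A - A ∘ₗ lieDeriv lam X
  map_add' A B := by
    rw [LinearMap.comp_add, LinearMap.add_comp]; abel
  map_smul' c A := by
    rw [LinearMap.comp_smul, LinearMap.smul_comp, RingHom.id_apply]
    exact (smul_sub c (lieDeriv lam X ∘ₗ A) (A ∘ₗ lieDeriv lam X)).symm

/-- The linear endomorphisms `A` of the space of tensor densities of degree `lam` on `M` whose
restriction to the open set `U` is a differential operator of order at most `k`: in each chart,
`A φ` is given over `U` by `∑ j ≤ k, a_j^{i₁ … iⱼ} ∂_{i₁} ⋯ ∂_{iⱼ} φ` with smooth coefficients. -/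
def diffOpOn (lam : 𝕜) (k : ℕ) (U : Set M) :
    Submodule 𝕜 (Module.End 𝕜 (DensitySpace n M lam)) where
  carrier := {A | ∀ e ∈ IsManifold.maximalAtlas (𝓡 n) ∞ M,
    ∃ a : (j : ℕ) → (Fin j → Fin n) → Eucl n → 𝕜,
      (∀ j I, ContDiffOn ℝ ∞ (a j I) (e.target ∩ e.symm ⁻¹' U)) ∧
      ∀ φ : DensitySpace n M lam, ∀ y ∈ e.target ∩ e.symm ⁻¹' U,
        coeff e (A φ).1 y = diffExpr k a (coeff e φ.1) y}
  zero_mem' e _ := ⟨fun _ _ _ => 0, fun _ _ => contDiffOn_const, fun φ y _ => by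
    change (0 : 𝕜) = _
    simp [diffExpr]⟩
  add_mem' {A B} hA hB e he := by
    obtain ⟨a, ha, hA⟩ := hA e he
    obtain ⟨b, hb, hB⟩ := hB e he
    refine ⟨fun j I y => a j I y + b j I y, fun j I => (ha j I).add (hb j I), fun φ y hy => ?_⟩
    change coeff e (A φ).1 y + coeff e (B φ).1 y = _
    rw [hA φ y hy, hB φ y hy]
    simp only [diffExpr, add_mul, Finset.sum_add_distrib]
  smul_mem' c A hA e he := by
    obtain ⟨a, ha, hA⟩ := hA e he
    refine ⟨fun j I y => c * a j I y, fun j I => contDiffOn_const.mul (ha j I), fun φ y hy => ?_⟩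
    change c * coeff e (A φ).1 y = _
    rw [hA φ y hy]
    simp only [diffExpr, Finset.mul_sum, mul_assoc]

theorem lieOp_mem {lam : 𝕜} {k : ℕ} {U : Set M} (hU : IsOpen U) (X : VectorFields n M)
    {A : Module.End 𝕜 (DensitySpace n M lam)} (hA : A ∈ diffOpOn lam k U) :
    lieOp lam X A ∈ diffOpOn lam k U := by
  intro e he
  obtain ⟨a, ha, hA⟩ := hA e he
  have hΩ : IsOpen (e.target ∩ e.symm ⁻¹' U) := e.isOpen_inter_preimage_symm hU
  have hP : IsDO (e.target ∩ e.symm ⁻¹' U) k (diffExpr k a) := ⟨a, ha, fun _ _ _ _ => rfl⟩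
  have hZ := (contDiffOn_chartVF he X).mono (t := e.target ∩ e.symm ⁻¹' U) Set.inter_subset_left
  obtain ⟨b, hb, h⟩ := hP.comm hΩ lam hZ
  refine ⟨b, hb, fun φ y hy => ?_⟩
  rw [← h _ ((φ.2.2 e he).mono Set.inter_subset_left) y hy]
  have e1 : coeff e (lieDeriv lam X (A φ)).1 y = localLie lam (chartVF e X) (coeff e (A φ).1) y :=
    coeff_lieDerivFun (A φ).2 X he hy.1
  have e2 := localLie_congr_on hΩ lam (chartVF e X) (hA φ) hy
  have e3 := hA (lieDeriv lam X φ) y hy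
  have e4 : ∀ z ∈ e.target ∩ e.symm ⁻¹' U,
      coeff e (lieDeriv lam X φ).1 z = localLie lam (chartVF e X) (coeff e φ.1) z :=
    fun z hz => coeff_lieDerivFun φ.2 X he hz.1
  have e5 := diffExpr_congr_on (k := k) (a := a) hΩ e4 hy
  beta_reduce
  rw [← e2, ← e1, ← e5, ← e3]
  rfl

/-- The space `D^k_lam(M)` of linear differential operators of order at most `k` on the tensor
densities of degree `lam` on `M`. -/
def diffOp (n : ℕ) (M : Type*) [TopologicalSpace M] [ChartedSpace (Eucl n) M]
    [IsManifold (𝓡 n) ∞ M] (lam : 𝕜) (k : ℕ) :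
    Submodule 𝕜 (Module.End 𝕜 (DensitySpace n M lam)) :=
  diffOpOn lam k Set.univ

/-- The quotient `D^k_lam(M) / D^l_lam(M)`. -/
abbrev DiffOpQuot (n : ℕ) (M : Type*) [TopologicalSpace M] [ChartedSpace (Eucl n) M]
    [IsManifold (𝓡 n) ∞ M] (lam : 𝕜) (k l : ℕ) :=
  diffOp n M lam k ⧸ (diffOp n M lam l).submoduleOf (diffOp n M lam k)

/-- The action of a vector field `X` on `D^k_lam(M)`. -/
def lieOnDiffOp (lam : 𝕜) (k : ℕ) (X : VectorFields n M) :
    diffOp n M lam k →ₗ[𝕜] diffOp n M lam k :=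
  (lieOp lam X).restrict fun _ hA => lieOp_mem isOpen_univ X hA

/-- The action of a vector field `X` on `D^k_lam(M) / D^l_lam(M)`, induced by its action on
`D^k_lam(M)`. -/
def lieOnQuot (lam : 𝕜) (k l : ℕ) (X : VectorFields n M) :
    DiffOpQuot n M lam k l →ₗ[𝕜] DiffOpQuot n M lam k l :=
  Submodule.mapQ _ _ (lieOnDiffOp lam k X) fun A hA =>
    (lieOp_mem isOpen_univ X hA : lieOp lam X A.1 ∈ diffOp n M lam l)

/-- The elements of `D^k_lam(M) / D^l_lam(M)` that vanish on the open set `U`: the classes of the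
differential operators whose restriction to `U` has order at most `l`. -/
def vanishingOn (lam : 𝕜) (k l : ℕ) (U : Set M) : Submodule 𝕜 (DiffOpQuot n M lam k l) :=
  ((diffOpOn lam l U).submoduleOf (diffOp n M lam k)).map (Submodule.mkQ _)

/-- A linear map from `D^k_lam(M) / D^l_lam(M)` to `D^k_mu(M) / D^l_mu(M)` is equivariant if it
commutes with the actions of all smooth vector fields. -/
def IsVectEquivariant {lam mu : 𝕜} {k l : ℕ}
    (T : DiffOpQuot n M lam k l →ₗ[𝕜] DiffOpQuot n M mu k l) : Prop :=
  ∀ (X : VectorFields n M) (A : DiffOpQuot n M lam k l),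
    T (lieOnQuot lam k l X A) = lieOnQuot mu k l X (T A)

/-- A linear map from `D^k_lam(M) / D^l_lam(M)` to `D^k_mu(M) / D^l_mu(M)` is local if `T A`
vanishes on each open set on which `A` vanishes. -/
def IsLocalMap {lam mu : 𝕜} {k l : ℕ}
    (T : DiffOpQuot n M lam k l →ₗ[𝕜] DiffOpQuot n M mu k l) : Prop :=
  ∀ U : Set M, IsOpen U → ∀ A ∈ vanishingOn lam k l U, T A ∈ vanishingOn mu k l U

end Operators

end DensOp

end

namespace DensOp

/-! ### Commutation with the Euler vector field in coordinates -/

section Local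

variable {𝕜 : Type*} [RCLike 𝕜] {n : ℕ}

/-! The proof characterises "order at most `l` on `U`" by the action of vector fields alone, so that
an equivariant map must respect it. Let `A` have order at most `l` on `U`, and let `B` represent the
image of its class.

From `A` to fields (`exists_nhds_lieOp_mem`): each point of `U` has a neighbourhood `V` such that,
for every field `X` supported in `V`, the operator `L_X A` has order at most `l` on all of `M`.
Inside `U` this is inherited from `A`, and off the support of `X` the operator `L_X A` is zero. So
`X` kills the class of `A`, hence by equivariance the class of `B`, which means that `L_X B` has
order at most `l`.

From fields back to `B` (`mem_diffOpOn_of_lieOp_mem`): near a given point `p` of `U`, take `X` to be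
the Euler field `y - p`, cut off (`exists_vectorField`). At `p`, bracketing with `X` multiplies the
part of `B` of degree `j` by `-j`, whatever the density weight. Since `L_X B` has no part of degree
`j > l`, and such a `j` is nonzero, neither has `B` (`homogPart_eq_zero`). The point `p` was
arbitrary in `U`. -/

theorem fderiv_sub_const_id (p y : Eucl n) :
    fderiv ℝ (fun z : Eucl n => z - p) y = ContinuousLinearMap.id ℝ (Eucl n) := by
  rw [fderiv_sub_const, fderiv_fun_id]

theorem divergence_euler (p y : Eucl n) : divergence (fun z : Eucl n => z - p) y = n := by
  rw [divergence, fderiv_sub_const_id]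
  simp

/-- The Euler field vanishes at its centre, so the transport term drops out and only its constant
divergence `n` contributes. -/
theorem localLie_euler_self (lam : 𝕜) (p : Eucl n) (g : Eucl n → 𝕜) :
    localLie lam (fun z => z - p) g p = lam * n * g p := by
  simp [localLie, divergence_euler]

/-- Partial derivatives of order `j` are homogeneous of weight `j` for the Euler vector field. -/
theorem partialD_localLie_euler {Ω : Set (Eucl n)} (hΩ : IsOpen Ω) (lam : 𝕜) (p : Eucl n)
    {g : Eucl n → 𝕜} (hg : ContDiffOn ℝ ∞ g Ω) {j : ℕ} (I : Fin j → Fin n) :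
    ∀ y ∈ Ω, partialD I (localLie lam (fun z => z - p) g) y =
      localLie lam (fun z => z - p) (partialD I g) y + j * partialD I g y := by
  have hZ : ContDiffOn ℝ ∞ (fun z : Eucl n => z - p) Ω := contDiffOn_id.sub contDiffOn_const
  induction j with
  | zero => intro y _; simp [partialD_zero, localLie, show partialD I g = g from rfl]
  | succ j ih =>
    obtain ⟨i, I, rfl⟩ : ∃ i J, I = Fin.cons i J := ⟨I 0, Fin.tail I, (Fin.cons_self_tail I).symm⟩
    intro y hy
    have hI := contDiffOn_partialD hΩ I hg
    have hL := contDiffOn_localLie hΩ lam hZ hg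
    -- The Euler field has identity derivative and constant divergence, so its commutator with `∂ᵢ`
    -- is `-∂ᵢ`: each further derivative raises the weight by exactly one.
    have e1 := localLie_comm_fderiv hΩ lam hZ hI (EuclideanSpace.single i 1) hy
    have e2 : fderiv ℝ (fun z => localLie lam (fun z => z - p) (partialD I g) z
        + j * partialD I g z) y = fderiv ℝ (localLie lam (fun z => z - p) (partialD I g)) y
          + (j : 𝕜) • fderiv ℝ (partialD I g) y := by
      rw [fderiv_fun_add (diffAt hΩ (contDiffOn_localLie hΩ lam hZ hI) hy)
        ((diffAt hΩ hI hy).const_mul _), fderiv_const_mul (diffAt hΩ hI hy)]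
    rw [localLie_congr_on hΩ lam _ (fun z hz => partialD_cons hΩ i I hg hz) hy,
      partialD_cons hΩ i I hL hy, partialD_cons hΩ i I hg hy, fderiv_congr_on hΩ (ih I) hy, e2]
    simp only [divergence_euler, fderiv_sub_const_id] at e1
    simp only [add_apply, smul_apply, smul_eq_mul]
    push_cast
    simp at e1
    linear_combination -e1

/-- Only the value and the first derivative of the field at the point enter. This allows a cut-off
field to be replaced by its model where the cut-off function is locally constant. -/
theorem localLie_congr_vf (lam : 𝕜) {Y Z : Eucl n → Eucl n} (g : Eucl n → 𝕜) {y : Eucl n}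
    (h : Y =ᶠ[𝓝 y] Z) : localLie lam Y g y = localLie lam Z g y := by
  rw [localLie, localLie, divergence, divergence, h.fderiv_eq, h.eq_of_nhds]

theorem localLie_zero_vf (lam : 𝕜) (g : Eucl n → 𝕜) (y : Eucl n) :
    localLie lam (fun _ => 0) g y = 0 := by
  simp [localLie, divergence]

end Local

/-! ### Vector fields with prescribed germ -/

section Manifold

variable {𝕜 : Type*} [RCLike 𝕜] {n : ℕ} {M : Type*} [TopologicalSpace M]
  [ChartedSpace (Eucl n) M] [IsManifold (𝓡 n) ∞ M]

/-- Invertibility is what makes the pullback of a coordinate field along `e` smooth, and what lets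
`e` push it forward to the original field. -/
theorem isInvertible_mfderiv {e : OpenPartialHomeomorph M (Eucl n)}
    (he : e ∈ IsManifold.maximalAtlas (𝓡 n) ∞ M) {x : M} (hx : x ∈ e.source) :
    (mfderiv (𝓡 n) (𝓡 n) e x).IsInvertible := by
  have h := (mdifferentiable_of_mem he).comp_symm_deriv (e.map_source hx)
  rw [e.left_inv hx] at h
  exact ContinuousLinearMap.IsInvertible.of_inverse h
    ((mdifferentiable_of_mem he).symm_comp_deriv hx)

/-- Any smooth vector field in a chart, cut off near a point, extends to the manifold. -/
theorem exists_vectorField [T2Space M] {e : OpenPartialHomeomorph M (Eucl n)}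
    (he : e ∈ IsManifold.maximalAtlas (𝓡 n) ∞ M) {Z : Eucl n → Eucl n} (hZ : ContDiff ℝ ∞ Z)
    {x : M} (hx : x ∈ e.source) {V : Set M} (hV : V ∈ 𝓝 x) :
    ∃ X : VectorFields n M, (∃ K ⊆ V, IsClosed K ∧ ∀ z ∉ K, X z = 0) ∧
      ∀ᶠ y in 𝓝 (e x), chartVF e X y = Z y := by
  obtain ⟨χ, -, hχ⟩ := (SmoothBumpFunction.nhds_basis_tsupport (I := 𝓡 n) x).mem_iff.1
    (Filter.inter_mem hV (e.open_source.mem_nhds hx))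
  have hs : ContMDiffOn (𝓡 n) (𝓡 n).tangent ∞ (fun z => (⟨z, VectorField.mpullback (𝓡 n) (𝓡 n) e Z z⟩ :
      TangentBundle (𝓡 n) M)) e.source := fun z hz =>
    (ContMDiffAt.mpullback_vectorField_preimage (contMDiffAt_vectorSpace_iff_contDiffAt.2
      hZ.contDiffAt) (contMDiffAt_of_mem_maximalAtlas he hz) (isInvertible_mfderiv he hz)
      (by simp)).contMDiffWithinAt
  -- The field is `χ` times the pullback of `Z` along `e`; the closed support of `χ` lies in the
  -- chart domain and in `V`, so extension by zero is smooth and `K` can be `tsupport χ`.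
  refine ⟨⟨_, ContMDiffOn.smul_section_of_tsupport χ.contMDiff.contMDiffOn e.open_source
    (fun z hz => (hχ hz).2) hs⟩, ⟨tsupport χ, fun z hz => (hχ hz).1, isClosed_tsupport _,
    fun z hz => ?_⟩, ?_⟩
  · change χ z • VectorField.mpullback (𝓡 n) (𝓡 n) e Z z = 0
    rw [image_eq_zero_of_notMem_tsupport hz, zero_smul]
  · have h1 : ∀ᶠ y in 𝓝 (e x), χ (e.symm y) = 1 := by
      have := (e.continuousAt_symm (e.map_source hx)).tendsto
      rw [e.left_inv hx] at this
      exact this.eventually χ.eventuallyEq_one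
    filter_upwards [h1, e.open_target.mem_nhds (e.map_source hx)] with y hy hyt
    change chartCoframe e (e.symm y)
      (χ (e.symm y) • VectorField.mpullback (𝓡 n) (𝓡 n) e Z (e.symm y)) = _
    have hinv := DFunLike.congr_fun (isInvertible_mfderiv he (e.map_target hyt)).self_comp_inverse
      (Z (e (e.symm y)))
    rw [hy, one_smul]
    refine hinv.trans ?_
    rw [e.right_inv hyt]
    rfl

theorem chartVF_eventually_zero {e : OpenPartialHomeomorph M (Eucl n)} {X : VectorFields n M}
    {K : Set M} (hK : IsClosed K) (hX : ∀ z ∉ K, X z = 0) {y : Eucl n} (hy : y ∈ e.target)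
    (hyK : e.symm y ∉ K) : chartVF e X =ᶠ[𝓝 y] fun _ => 0 := by
  filter_upwards [(e.isOpen_inter_preimage_symm hK.isOpen_compl).mem_nhds ⟨hy, hyK⟩] with z hz
  rw [chartVF, hX _ hz.2, map_zero]

/-! ### Lie derivatives of operators along fields of small support -/

theorem coeff_lieDeriv {lam : 𝕜} {e : OpenPartialHomeomorph M (Eucl n)}
    (he : e ∈ IsManifold.maximalAtlas (𝓡 n) ∞ M) (X : VectorFields n M)
    (φ : DensitySpace n M lam) {y : Eucl n} (hy : y ∈ e.target) :
    coeff e (lieDeriv lam X φ).1 y = localLie lam (chartVF e X) (coeff e φ.1) y :=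
  coeff_lieDerivFun φ.2 X he hy

theorem coeff_lieOp {lam : 𝕜} (e : OpenPartialHomeomorph M (Eucl n)) (X : VectorFields n M)
    (A : Module.End 𝕜 (DensitySpace n M lam)) (φ : DensitySpace n M lam) (y : Eucl n) :
    coeff e (lieOp lam X A φ).1 y =
      coeff e (lieDeriv lam X (A φ)).1 y - coeff e (A (lieDeriv lam X φ)).1 y :=
  rfl

/-- The Lie derivative of a differential operator vanishes where the vector field does. -/
theorem coeff_lieOp_eq_zero {lam : 𝕜} {k : ℕ} {e : OpenPartialHomeomorph M (Eucl n)}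
    (he : e ∈ IsManifold.maximalAtlas (𝓡 n) ∞ M) {X : VectorFields n M}
    {K : Set M} (hK : IsClosed K) (hX : ∀ z ∉ K, X z = 0)
    {A : Module.End 𝕜 (DensitySpace n M lam)} (hA : A ∈ diffOp n M lam k)
    (φ : DensitySpace n M lam) {y : Eucl n} (hy : y ∈ e.target) (hyK : e.symm y ∉ K) :
    coeff e (lieOp lam X A φ).1 y = 0 := by
  obtain ⟨a, -, hA⟩ := hA e he
  have hO : IsOpen (e.target ∩ e.symm ⁻¹' Kᶜ) := e.isOpen_inter_preimage_symm hK.isOpen_compl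
  have h0 : ∀ ψ : DensitySpace n M lam, ∀ z ∈ e.target ∩ e.symm ⁻¹' Kᶜ,
      coeff e (lieDeriv lam X ψ).1 z = 0 := fun ψ z hz => by
    rw [coeff_lieDeriv he X ψ hz.1,
      localLie_congr_vf lam _ (chartVF_eventually_zero hK hX hz.1 hz.2), localLie_zero_vf]
  -- The second term of the commutator vanishes because `A` is local: `L_X φ` is zero on a
  -- neighbourhood of the point, hence so are all its partial derivatives there.
  rw [coeff_lieOp, h0 _ y ⟨hy, hyK⟩, hA _ y ⟨hy, trivial⟩,
    diffExpr_congr_on hO (h := fun _ => 0) (h0 φ) ⟨hy, hyK⟩]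
  simp [diffExpr, partialD]

/-- If `A` has order at most `l` on `U` then its Lie derivative along a vector field supported
near a point of `U` has order at most `l` everywhere. -/
theorem exists_nhds_lieOp_mem [T2Space M] {lam : 𝕜} {k l : ℕ} {U : Set M} (hU : IsOpen U)
    {A : Module.End 𝕜 (DensitySpace n M lam)} (hA : A ∈ diffOp n M lam k)
    (hAU : A ∈ diffOpOn lam l U) {x : M} (hx : x ∈ U) :
    ∃ V ∈ 𝓝 x, ∀ X : VectorFields n M, (∃ K ⊆ V, IsClosed K ∧ ∀ z ∉ K, X z = 0) →
      lieOp lam X A ∈ diffOp n M lam l := by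
  obtain ⟨ρ, -, hρ⟩ := (SmoothBumpFunction.nhds_basis_tsupport (I := 𝓡 n) x).mem_iff.1
    (hU.mem_nhds hx)
  -- With `V` the set where `ρ = 1`, multiplication by `ρ` does not alter `L_X A` for `X` supported
  -- in `V`. So its coefficients over `U` may be multiplied by `ρ`, which makes them globally
  -- smooth.
  refine ⟨{z | ρ z = 1}, ρ.eventuallyEq_one, fun X ⟨K, hKV, hK, hX⟩ e he => ?_⟩
  obtain ⟨a, ha, h⟩ := lieOp_mem hU X hAU e he
  refine ⟨fun j I y => ((ρ (e.symm y) : ℝ) : 𝕜) * a j I y, fun j I y hy => ?_, fun φ y hy => ?_⟩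
  · have hρs : ContDiffAt ℝ ∞ (fun z => ((ρ (e.symm z) : ℝ) : 𝕜)) y :=
      (RCLike.ofRealCLM (K := 𝕜)).contDiff.contDiffAt.comp y
        (contMDiffAt_iff_contDiffAt.1 (ρ.contMDiffAt.comp y
          (contMDiffAt_symm_of_mem_maximalAtlas he hy.1)))
    by_cases hyU : e.symm y ∈ U
    · exact (hρs.mul ((ha j I).contDiffAt
        ((e.isOpen_inter_preimage_symm hU).mem_nhds ⟨hy.1, hyU⟩))).contDiffWithinAt
    -- Nothing is known about `a` outside `U`, but `tsupport ρ` lies inside `U`, so the product is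
    -- zero near such a point.
    · refine ContDiffAt.contDiffWithinAt (contDiffAt_const (c := (0 : 𝕜)) |>.congr_of_eventuallyEq ?_)
      filter_upwards [(e.isOpen_inter_preimage_symm (isClosed_tsupport ρ).isOpen_compl).mem_nhds
        ⟨hy.1, fun h' => hyU (hρ h')⟩] with z hz
      rw [image_eq_zero_of_notMem_tsupport hz.2]
      simp
  · have hmul : diffExpr l (fun j I y => ((ρ (e.symm y) : ℝ) : 𝕜) * a j I y) (coeff e φ.1) y =
        ((ρ (e.symm y) : ℝ) : 𝕜) * diffExpr l a (coeff e φ.1) y := by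
      simp only [diffExpr, Finset.mul_sum, mul_assoc]
    rw [hmul]
    by_cases hyU : e.symm y ∈ U
    · rw [← h φ y ⟨hy.1, hyU⟩]
      by_cases hyK : e.symm y ∈ K
      · rw [show ρ (e.symm y) = 1 from hKV hyK]
        simp
      · rw [coeff_lieOp_eq_zero he hK hX hA φ hy.1 hyK, mul_zero]
    · have h1 : e.symm y ∉ tsupport ρ := fun h' => hyU (hρ h')
      have h2 : e.symm y ∉ K := fun h' => by
        have h3 : ρ (e.symm y) = 1 := hKV h'
        rw [image_eq_zero_of_notMem_tsupport h1] at h3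
        exact zero_ne_one h3
      rw [image_eq_zero_of_notMem_tsupport h1, coeff_lieOp_eq_zero he hK hX hA φ hy.1 h2]
      simp

/-! ### The homogeneous parts of a differential operator at a point -/

/-- The homogeneous part of degree `j` of a differential expression. -/
noncomputable def homogPart (a : (j : ℕ) → (Fin j → Fin n) → Eucl n → 𝕜) (j : ℕ)
    (g : Eucl n → 𝕜) (y : Eucl n) : 𝕜 :=
  ∑ I : Fin j → Fin n, a j I y * partialD I g y

/-- The degree `j` part at `p` is an eigenvector for precomposition with `L_X`: the divergence gives
`mu * n` and the `j` partial derivatives give `j`. As the coefficients are arbitrary, this applies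
both to an operator and to its Lie derivative, and iterating it supplies the powers for a
Vandermonde argument. -/
theorem homogPart_lieDeriv_iterate {mu : 𝕜} {e : OpenPartialHomeomorph M (Eucl n)}
    (he : e ∈ IsManifold.maximalAtlas (𝓡 n) ∞ M) {X : VectorFields n M} {p : Eucl n}
    (hp : p ∈ e.target) (hX : ∀ᶠ y in 𝓝 p, chartVF e X y = y - p)
    (a : (j : ℕ) → (Fin j → Fin n) → Eucl n → 𝕜) (j m : ℕ) (φ : DensitySpace n M mu) :
    homogPart a j (coeff e ((lieDeriv mu X)^[m] φ).1) p =
      (mu * n + j) ^ m * homogPart a j (coeff e φ.1) p := by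
  have hstep : ∀ ψ : DensitySpace n M mu, homogPart a j (coeff e (lieDeriv mu X ψ).1) p =
      (mu * n + j) * homogPart a j (coeff e ψ.1) p := fun ψ => by
    obtain ⟨O, hO, hOo, hpO⟩ := eventually_nhds_iff.1 hX
    have hΩ : IsOpen (O ∩ e.target) := hOo.inter e.open_target
    have hψ : ContDiffOn ℝ ∞ (coeff e ψ.1) (O ∩ e.target) :=
      (ψ.2.2 e he).mono Set.inter_subset_right
    have h1 : ∀ y ∈ O ∩ e.target, coeff e (lieDeriv mu X ψ).1 y =
        localLie mu (fun z => z - p) (coeff e ψ.1) y := fun y hy => by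
      rw [coeff_lieDeriv he X ψ hy.2]
      exact localLie_congr_vf mu _ (Filter.eventually_of_mem (hOo.mem_nhds hy.1) hO)
    rw [homogPart, homogPart, Finset.mul_sum]
    refine Finset.sum_congr rfl fun I _ => ?_
    have h2 : partialD I (coeff e (lieDeriv mu X ψ).1) p =
        partialD I (localLie mu (fun z => z - p) (coeff e ψ.1)) p := by
      have h3 : coeff e (lieDeriv mu X ψ).1 =ᶠ[𝓝 p]
          localLie mu (fun z => z - p) (coeff e ψ.1) :=
        Filter.eventually_of_mem (hΩ.mem_nhds ⟨hpO, hp⟩) h1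
      rw [partialD, partialD, (h3.iteratedFDeriv ℝ j).eq_of_nhds]
    rw [h2, partialD_localLie_euler hΩ mu p hψ I p ⟨hpO, hp⟩, localLie_euler_self]
    ring
  induction m generalizing φ with
  | zero => simp
  | succ m ih =>
    rw [Function.iterate_succ_apply, ih, hstep]
    ring

/-- A differential operator whose Lie derivative along a vector field with the germ of the Euler
vector field at `p` has order at most `l` has no homogeneous part of degree `j > l` at `p`. -/
theorem homogPart_eq_zero {mu : 𝕜} {k l : ℕ} {B : Module.End 𝕜 (DensitySpace n M mu)}
    {e : OpenPartialHomeomorph M (Eucl n)}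
    (he : e ∈ IsManifold.maximalAtlas (𝓡 n) ∞ M) {X : VectorFields n M} {p : Eucl n}
    (hp : p ∈ e.target) (hX : ∀ᶠ y in 𝓝 p, chartVF e X y = y - p)
    {b : (j : ℕ) → (Fin j → Fin n) → Eucl n → 𝕜}
    (hB : ∀ φ : DensitySpace n M mu, coeff e (B φ).1 p = diffExpr k b (coeff e φ.1) p)
    (hXB : lieOp mu X B ∈ diffOp n M mu l) (hlk : l ≤ k) {j : ℕ} (hlj : l < j) (hjk : j ≤ k)
    (φ : DensitySpace n M mu) : homogPart b j (coeff e φ.1) p = 0 := by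
  obtain ⟨c, -, hc⟩ := hXB e he
  have hLie : ∀ a j (ψ : DensitySpace n M mu),
      homogPart a j (coeff e (lieDeriv mu X ψ).1) p =
        (mu * n + j) * homogPart a j (coeff e ψ.1) p := fun a j ψ => by
    simpa using homogPart_lieDeriv_iterate he hp hX a j 1 ψ
  -- This is `L_X B = C` evaluated at `p`, with `C` given by the coefficients `c`. On the left the
  -- weights `mu * n` and `mu * n + i` leave `-i` times the part of degree `i`; the parts of `C` are
  -- padded by zero above degree `l`.
  have hrel : ∀ ψ : DensitySpace n M mu, ∑ i ∈ Finset.range (k + 1),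
      (i * homogPart b i (coeff e ψ.1) p
        + if i ∈ Finset.range (l + 1) then homogPart c i (coeff e ψ.1) p else 0) = 0 := fun ψ => by
    have h1 := hc ψ p ⟨hp, trivial⟩
    rw [coeff_lieOp, coeff_lieDeriv he X _ hp, localLie_congr_vf mu _ hX, localLie_euler_self,
      hB, hB] at h1
    change mu * n * ∑ i ∈ Finset.range (k + 1), homogPart b i (coeff e ψ.1) p
      - ∑ i ∈ Finset.range (k + 1), homogPart b i (coeff e (lieDeriv mu X ψ).1) p
      = ∑ i ∈ Finset.range (l + 1), homogPart c i (coeff e ψ.1) p at h1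
    rw [Finset.sum_add_distrib, Finset.sum_ite_mem, Finset.inter_eq_right.2
      (Finset.range_mono (Nat.succ_le_succ hlk)), ← h1, Finset.mul_sum, ← Finset.sum_sub_distrib,
      ← Finset.sum_add_distrib]
    refine Finset.sum_eq_zero fun i _ => ?_
    rw [hLie]
    ring
  set v : Fin (k + 1) → 𝕜 := fun i => i * homogPart b i (coeff e φ.1) p
    + if (i : ℕ) ∈ Finset.range (l + 1) then homogPart c i (coeff e φ.1) p else 0 with hv
  have hv0 : v = 0 := by
    -- The relation fixes only a sum over degrees. Testing it on iterates of `L_X` applied to `φ`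
    -- weights the terms by powers of the distinct numbers `mu * n + i`, so Vandermonde forces each
    -- term to vanish. No densities with prescribed jets have to be constructed.
    refine Matrix.eq_zero_of_forall_pow_sum_mul_pow_eq_zero
      (f := fun i : Fin (k + 1) => mu * n + (i : ℕ)) (fun i i' h => ?_) fun m => ?_
    · exact Fin.ext (Nat.cast_injective (R := 𝕜) (add_left_cancel h))
    · rw [← hrel ((lieDeriv mu X)^[m] φ), ← Fin.sum_univ_eq_sum_range (fun i =>
        (i * homogPart b i (coeff e ((lieDeriv mu X)^[m] φ).1) p
          + if i ∈ Finset.range (l + 1) then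
            homogPart c i (coeff e ((lieDeriv mu X)^[m] φ).1) p else 0))]
      refine Finset.sum_congr rfl fun i _ => ?_
      rw [homogPart_lieDeriv_iterate he hp hX, homogPart_lieDeriv_iterate he hp hX]
      simp only [hv, add_mul, ite_mul, zero_mul]
      split_ifs <;> ring
  have h2 := congrFun hv0 ⟨j, Nat.lt_succ_of_le hjk⟩
  -- Here `l < j` gives `j > 0`, so the factor `j` can be cancelled; the same inequality removes the
  -- contribution of `c`.
  have h4 : (j : 𝕜) ≠ 0 := Nat.cast_ne_zero.2 (by omega)
  simpa [hv, h4, hlj.not_ge] using h2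

/-- A differential operator, all of whose Lie derivatives along vector fields supported near points
of `U` have order at most `l`, has order at most `l` on `U`. -/
theorem mem_diffOpOn_of_lieOp_mem [T2Space M] {mu : 𝕜} {k l : ℕ} (hlk : l ≤ k) {U : Set M}
    {B : Module.End 𝕜 (DensitySpace n M mu)} (hB : B ∈ diffOp n M mu k)
    (h : ∀ x ∈ U, ∃ V ∈ 𝓝 x, ∀ X : VectorFields n M,
      (∃ K ⊆ V, IsClosed K ∧ ∀ z ∉ K, X z = 0) → lieOp mu X B ∈ diffOp n M mu l) :
    B ∈ diffOpOn mu l U := by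
  intro e he
  obtain ⟨b, hb, hB⟩ := hB e he
  -- The coefficients of `B` are kept and the sum is truncated at degree `l`. The discarded parts
  -- are shown to vanish on every density, one point at a time, with an Euler field centred at that
  -- point. The individual coefficients need not vanish, since they are not symmetrised.
  refine ⟨b, fun j I => (hb j I).mono fun y hy => ⟨hy.1, trivial⟩, fun φ y hy => ?_⟩
  obtain ⟨V, hV, hVX⟩ := h _ hy.2
  obtain ⟨X, hXK, hX⟩ := exists_vectorField he (Z := fun z => z - y)
    (contDiff_id.sub contDiff_const) (e.map_target hy.1) hV
  rw [e.right_inv hy.1] at hX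
  rw [hB φ y ⟨hy.1, trivial⟩]
  refine (Finset.sum_subset (Finset.range_mono (Nat.succ_le_succ hlk)) fun j hj hj' => ?_).symm
  rw [Finset.mem_range] at hj hj'
  exact homogPart_eq_zero he hy.1 hX (fun ψ => hB ψ y ⟨hy.1, trivial⟩) (hVX X hXK) hlk
    (by omega) (by omega) φ

end Manifold

end DensOp

theorem proposition7p1 {𝕜 : Type*} [RCLike 𝕜] {n : ℕ} {M : Type*} [TopologicalSpace M] [T2Space M]
    [ChartedSpace (EuclideanSpace ℝ (Fin n)) M] [IsManifold (𝓡 n) ∞ M]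
    (lam mu : 𝕜) (k l : ℕ) (hkl : l < k)
    (T : DensOp.DiffOpQuot n M lam k l →ₗ[𝕜] DensOp.DiffOpQuot n M mu k l)
    (hT : DensOp.IsVectEquivariant T) :
    DensOp.IsLocalMap T := by
  rintro U hU _ ⟨A, hAU, rfl⟩
  obtain ⟨B, hB⟩ := Submodule.mkQ_surjective _ (T (Submodule.mkQ _ A))
  refine ⟨B, DensOp.mem_diffOpOn_of_lieOp_mem hkl.le B.2 fun x hx => ?_, hB⟩
  obtain ⟨V, hV, hVX⟩ := DensOp.exists_nhds_lieOp_mem hU A.2 hAU hx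
  -- The neighbourhood found for `A` also serves for `B`: equivariance carries `L_X [A] = 0` to `L_X
  -- [B] = 0`, which says that `L_X B` has order at most `l`.
  refine ⟨V, hV, fun X hX => ?_⟩
  have h1 : DensOp.lieOnQuot lam k l X (Submodule.mkQ _ A) = 0 :=
    (Submodule.Quotient.mk_eq_zero _).2 (hVX X hX)
  have h2 := hT X (Submodule.mkQ _ A)
  rw [h1, map_zero, ← hB] at h2
  exact (Submodule.Quotient.mk_eq_zero
    ((DensOp.diffOp n M mu l).submoduleOf (DensOp.diffOp n M mu k))).1 h2.symm
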